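/- Let $K$ be a global field, i.e. a number field or a finitely generated extension of transcendence degree one of a finite field. Let $X$ be the associated scheme: $X=\operatorname{Spec}\mathcal{O}_K$ if $K$ is a number field, and $X$ the smooth projective curve with function field $K$ otherwise. The closed points $P$ of $X$ correspond bijectively, via $P\mapsto\mathcal{O}_{X,P}$, to the discrete valuation rings of $K$ (with fraction field $K$); let $\mathfrak{m}_P$ be the maximal ideal of $\mathcal{O}_{X,P}$. For a nonzero effective divisor $D=\sum_P \nu_P(D)\,P$ on $X$ put $$\mathcal{O}_D=\bigcap_{P\in\operatorname{Supp}D}\mathcal{O}_{X,P},\qquad I_D=\bigcap_{P\in\operatorname{Supp}D}\mathfrak{m}_P^{\nu_P(D)},\qquad \mathsf{N}_K(D)=\#(\mathcal{O}_D/I_D),\qquad \varphi_K(D)=\#(\mathcal{O}_D/I_D)^\times,$$ and put $\mathsf{N}_K(0)=\varphi_K(0)=1$. For $s\in\mathbb{C}$ with real part $\sigma$ consider $$\zeta_K(s)=\sum_{D\ge 0}\mathsf{N}_K(D)^{-s},\qquad T_K(s)=\sum_{D\ge 0}\varphi_K(D)^{-s},\qquad f_K(s)=\prod_{P}\left[1+(\mathsf{N}_K(P)-1)^{-s}-\mathsf{N}_K(P)^{-s}\right],$$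 where the sums range over all effective divisors of $X$ and the product over all closed points of $X$. Then: 1. The series $T_K(s)$ converges absolutely for $\sigma>1$, and uniformly on every half plane $\sigma\ge 1+\delta$ with $\delta>0$ (hence locally uniformly on $\sigma>1$). 2. For $\sigma>1$ the series $\zeta_K(s)$ converges absolutely, $\zeta_K(s)\ne 0$, and $T_K(s)=\zeta_K(s)\,f_K(s)$, i.e. $T_K(s)/\zeta_K(s)=f_K(s)$. 3. The product $f_K(s)$ converges absolutely (that is, $\sum_P\left|(\mathsf{N}_K(P)-1)^{-s}-\mathsf{N}_K(P)^{-s}\right|<\infty$) and locally uniformly for $\sigma>0$, and $f_K$ is holomorphic on $\sigma>0$. -/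

import Mathlib

open scoped BigOperators Topology

noncomputable section

namespace GlobalTotient

/-- A global field: either a number field, or a global function field, i.e. a finitely generated
extension of transcendence degree one of some finite field `F`, which means that `K` is a finite
extension of a rational function field `F(t)`. -/
def IsGlobalField (K : Type*) [Field K] : Prop :=
  NumberField K ∨
    ∃ F : Subfield K, Finite F ∧
      ∃ t : K, Transcendental F t ∧ FiniteDimensional (IntermediateField.adjoin F {t}) K

/-- The closed points `P` of the scheme `X` associated to the global field `K`, each given by its
local ring `𝒪_{X,P}` as a subring of the function field `K` of `X`. These local rings are exactly
the discrete valuation rings of `K`: for a number field, the localizations of the ring of integers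
at its maximal ideals (see `isDiscreteValuationRing_iff_of_numberField`); for a function field, the
discrete valuation rings of `K` over the constants, which are the points of its smooth projective
model (the constants lie in every valuation ring, see `subfield_le_valuationSubring`). -/
def ClosedPoint (K : Type*) [Field K] : Type _ :=
  {A : ValuationSubring K // IsDiscreteValuationRing A}

/-- The effective Weil divisors of `X`: finite formal sums of closed points with coefficients
in `ℕ`. -/
abbrev EffDivisor (K : Type*) [Field K] : Type _ := ClosedPoint K →₀ ℕ

variable {K : Type*} [Field K]

/-- A finite subfield is contained in every valuation ring of `K`. -/
theorem subfield_le_valuationSubring (F : Subfield K) [Finite F] (A : ValuationSubring K) :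
    F.toSubring ≤ A.toSubring := by
  intro x hx
  by_cases h0 : x = 0
  · simp [h0]
  obtain ⟨n, hn, h1⟩ := isOfFinOrder_iff_pow_eq_one.mp
    (isOfFinOrder_of_finite (Units.mk0 (⟨x, hx⟩ : F) (by simpa [Subtype.ext_iff] using h0)))
  have h2 : x ^ n = 1 := by
    have := congrArg (fun u : Fˣ => ((u : F) : K)) h1
    simpa using this
  rcases A.mem_or_inv_mem x with h | h
  · exact h
  · have h3 : x = x⁻¹ ^ (n - 1) := by
      rw [inv_pow]
      refine (eq_inv_of_mul_eq_one_left ?_)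
      rw [← pow_succ', Nat.sub_add_cancel hn, h2]
    rw [h3]
    exact A.toSubring.pow_mem h _

open IsDedekindDomain in
/-- For a number field, the discrete valuation rings of `K` are exactly the localizations of its
ring of integers at the nonzero prime ideals, i.e. the local rings at the closed points of
`Spec 𝒪_K`. -/
theorem isDiscreteValuationRing_iff_of_numberField [NumberField K] (A : ValuationSubring K) :
    IsDiscreteValuationRing A ↔
      ∃ v : HeightOneSpectrum (NumberField.RingOfIntegers K),
        A = HeightOneSpectrum.valuationSubringAtPrime K v := by
  constructor
  · intro hA
    have hint : ∀ x : NumberField.RingOfIntegers K, (x : K) ∈ A := by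
      intro x
      have hx : IsIntegral A (x : K) := (NumberField.RingOfIntegers.isIntegral_coe x).tower_top
      obtain ⟨y, hy⟩ := IsIntegrallyClosed.isIntegral_iff.mp hx
      rw [← hy]; exact y.2
    let f : NumberField.RingOfIntegers K →+* A :=
      (algebraMap (NumberField.RingOfIntegers K) K).codRestrict A.toSubring hint
    let p := (IsLocalRing.maximalIdeal A).comap f
    have hp : p.IsPrime := Ideal.comap_isPrime _ _
    have hunit : ∀ x : NumberField.RingOfIntegers K, x ∉ p → (x : K)⁻¹ ∈ A := by
      intro x hx
      have hu : IsUnit (f x) := by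
        by_contra h
        exact hx ((IsLocalRing.mem_maximalIdeal _).mpr h)
      obtain ⟨u, hu⟩ := hu
      have h1 : ((u : A) : K) = x := congrArg Subtype.val hu
      have h2 : ((u : A) : K) * ((u⁻¹ : Aˣ) : A) = 1 := by
        exact congrArg (Subtype.val : A → K) u.mul_inv
      rw [← h1, inv_eq_of_mul_eq_one_right h2]
      exact ((u⁻¹ : Aˣ) : A).2
    have hne : p ≠ ⊥ := by
      intro hb
      apply IsDiscreteValuationRing.not_isField A
      have htop : ∀ z : K, z ∈ A := by
        intro z
        obtain ⟨a, b, hb0, rfl⟩ := IsFractionRing.div_surjective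
          (A := NumberField.RingOfIntegers K) z
        rw [div_eq_mul_inv]
        refine A.mul_mem _ _ (hint a) (hunit b ?_)
        rw [hb]
        simpa using nonZeroDivisors.ne_zero hb0
      refine ⟨⟨0, 1, zero_ne_one⟩, mul_comm, fun {a} ha => ⟨⟨(a : K)⁻¹, htop _⟩, ?_⟩⟩
      apply Subtype.ext
      have : (a : K) ≠ 0 := fun h => ha (Subtype.ext h)
      simpa using mul_inv_cancel₀ this
    refine ⟨⟨p, hp, hne⟩, (ValuationSubring.eq_of_le_of_ne_top _ ?_ ?_).symm⟩
    · intro z hz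
      obtain ⟨a, s, hs, rfl⟩ := hz
      exact A.mul_mem _ _ (hint a) (hunit s hs)
    · rintro rfl
      apply IsDiscreteValuationRing.not_isField (⊤ : ValuationSubring K)
      refine ⟨⟨0, 1, zero_ne_one⟩, mul_comm, fun {a} ha => ⟨⟨(a : K)⁻¹, trivial⟩, ?_⟩⟩
      apply Subtype.ext
      have : (a : K) ≠ 0 := fun h => ha (Subtype.ext h)
      simpa using mul_inv_cancel₀ this
  · rintro ⟨v, rfl⟩
    rw [HeightOneSpectrum.valuationSubringAtPrime_eq_valuationSubring]
    exact (v.valuation K).valuationSubring_isDiscreteValuationRing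

/-- The ring `𝒪_D = ⋂_{P ∈ Supp D} 𝒪_{X,P}`. -/
def divisorRing (D : EffDivisor K) : Subring K :=
  ⨅ P : D.support, P.1.1.toSubring

/-- The inclusion of `𝒪_D` into `𝒪_{X,P}`, for `P` in the support of `D`. -/
def toLocalRing (D : EffDivisor K) (P : D.support) : divisorRing D →+* P.1.1 :=
  Subring.inclusion (iInf_le (fun Q : D.support => Q.1.1.toSubring) P)

/-- The ideal `I_D = ⋂_{P ∈ Supp D} 𝔪_P ^ {ν_P(D)}` of `𝒪_D`. -/
def divisorIdeal (D : EffDivisor K) : Ideal (divisorRing D) :=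
  ⨅ P : D.support, ((IsLocalRing.maximalIdeal P.1.1) ^ (D P.1)).comap (toLocalRing D P)

open Classical in
/-- The norm `N_K(D)`: it is `1` for `D = 0`, and `#(𝒪_D / I_D)` otherwise. -/
def norm (D : EffDivisor K) : ℕ :=
  if D = 0 then 1 else Nat.card (divisorRing D ⧸ divisorIdeal D)

open Classical in
/-- The Euler function `φ_K(D)`: it is `1` for `D = 0`, and `#(𝒪_D / I_D)ˣ` otherwise. -/
def euler (D : EffDivisor K) : ℕ :=
  if D = 0 then 1 else Nat.card (divisorRing D ⧸ divisorIdeal D)ˣ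

/-- The norm of a closed point, i.e. of the corresponding prime divisor. -/
def pointNorm (P : ClosedPoint K) : ℕ := norm (Finsupp.single P 1)

variable (K)

/-- The Weil zeta function `ζ_K(s) = ∑_{D ≥ 0} N_K(D)^{-s}` (for `Re s > 1`). -/
def weilZeta (s : ℂ) : ℂ := ∑' D : EffDivisor K, (norm D : ℂ) ^ (-s)

/-- The totient zeta function `T_K(s) = ∑_{D ≥ 0} φ_K(D)^{-s}`. -/
def totientZeta (s : ℂ) : ℂ := ∑' D : EffDivisor K, (euler D : ℂ) ^ (-s)

variable {K}

/-- The factor `1 + (N P - 1)^{-s} - (N P)^{-s}`. -/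
def eulerFactor (P : ClosedPoint K) (s : ℂ) : ℂ :=
  1 + ((pointNorm P : ℂ) - 1) ^ (-s) - (pointNorm P : ℂ) ^ (-s)

variable (K)

/-- The product `f_K(s) = ∏_P [1 + (N P - 1)^{-s} - (N P)^{-s}]` over all closed points. -/
def eulerProd (s : ℂ) : ℂ := ∏' P : ClosedPoint K, eulerFactor P s

end GlobalTotient

end

open scoped BigOperators Topology

noncomputable section

namespace GlobalTotient

variable {K : Type*} [Field K]

/-! Write `q` for the norm of `P`. Weak approximation gives `𝒪_D / I_D ≅ ∏ 𝒪_P / 𝔪_P ^ ν_P(D)`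
(`divisorRing_quotient_equiv`), so norm and Euler function are products of the local values `q ^ ν`
and `q ^ (ν - 1) * (q - 1)`. Both series are then Euler products, and the local identity `1 +
(q-1)^{-s} / (1 - q^{-s}) = (1 - q^{-s})⁻¹ (1 + (q-1)^{-s} - q^{-s})` yields `T_K = ζ_K f_K`.

Convergence rests on `∑_P q^{-σ} < ∞` for `σ > 1` (`finite_residue_and_summable`). Let `R` be `ℤ` or
`F[u]`, with `K` of degree `n` over `Frac R`. A point whose local ring contains `R` has a nonzero
center `p` on `R`, at most `n` points share a center, and `q ≥ #(R/p)`; the sum is at most `n ∑_p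
#(R/p)^{-σ}`. For function fields, `u = t` and `u = t⁻¹` together reach all points.

The mean value inequality bounds `(q-1)^{-s} - q^{-s}` by `|s| (q-1)^{-(σ+1)}`. The extra `1` in the
exponent carries `f_K` to `σ > 0`. -/

instance (P : ClosedPoint K) : IsDiscreteValuationRing P.1 := P.2

/-! ### Absolute values of closed points and weak approximation -/

/-- The absolute value of `K` attached to a closed point, normalized by `|ϖ| = 1 / 2`. -/
def pointAbv (P : ClosedPoint K) : AbsoluteValue K ℝ :=
  (IsDiscreteValuationRing.maximalIdeal P.1).adicAbv (K := K) (one_lt_two : (1 : NNReal) < 2)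

theorem pointAbv_lt_one_iff {P : ClosedPoint K} (x : P.1) :
    pointAbv P (x : K) < 1 ↔ x ∈ IsLocalRing.maximalIdeal P.1 :=
  (IsDiscreteValuationRing.maximalIdeal P.1).adicAbv_coe_lt_one_iff (K := K) _ x

theorem pointAbv_le_one_iff {P : ClosedPoint K} {x : K} : pointAbv P x ≤ 1 ↔ x ∈ P.1 := by
  constructor
  · intro h
    by_contra hx
    have hx0 : x ≠ 0 := fun h0 => hx (h0 ▸ P.1.zero_mem)
    have hinv : x⁻¹ ∈ P.1 := (P.1.mem_or_inv_mem x).resolve_left hx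
    have hm : (⟨x⁻¹, hinv⟩ : P.1) ∈ IsLocalRing.maximalIdeal P.1 := by
      rw [IsLocalRing.mem_maximalIdeal, mem_nonunits_iff]
      rintro ⟨u, hu⟩
      have h1 : ((u : P.1) : K) = x⁻¹ := congrArg Subtype.val hu
      have h2 : ((u : P.1) : K) * ((u⁻¹ : P.1ˣ) : P.1) = 1 :=
        congrArg (Subtype.val : P.1 → K) u.mul_inv
      apply hx
      rw [← inv_inv x, ← h1, inv_eq_of_mul_eq_one_right h2]
      exact ((u⁻¹ : P.1ˣ) : P.1).2
    have h3 := (pointAbv_lt_one_iff _).mpr hm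
    rw [map_inv₀] at h3
    have h4 : 0 < pointAbv P x := (pointAbv P).pos hx0
    rw [inv_lt_one₀ h4] at h3
    linarith
  · intro hx
    exact (IsDiscreteValuationRing.maximalIdeal P.1).adicAbv_coe_le_one (K := K) _ (⟨x, hx⟩ : P.1)

theorem pointAbv_isNontrivial (P : ClosedPoint K) : (pointAbv P).IsNontrivial := by
  obtain ⟨ϖ, hϖ⟩ := IsDiscreteValuationRing.exists_irreducible P.1
  refine ⟨ϖ, fun h => hϖ.ne_zero (Subtype.ext h), ne_of_lt ?_⟩
  rw [pointAbv_lt_one_iff]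
  exact (IsLocalRing.mem_maximalIdeal _).mpr hϖ.not_isUnit

/-- Equivalent absolute values have the same closed unit ball, which is the valuation ring. -/
theorem not_isEquiv_pointAbv {P Q : ClosedPoint K} (h : P ≠ Q) :
    ¬ (pointAbv P).IsEquiv (pointAbv Q) := by
  intro he
  apply h
  apply Subtype.ext
  ext x
  rw [← pointAbv_le_one_iff, ← pointAbv_le_one_iff, he.le_one_iff]

/-- The radius `ε = |ϖ ^ k|` works, since `|x| ≤ ε` puts `x / ϖ ^ k` in the local ring. This turns
approximation in absolute value into congruences. -/
theorem exists_pos_forall_mem_pow (P : ClosedPoint K) (k : ℕ) :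
    ∃ ε : ℝ, 0 < ε ∧ ∀ x : K, pointAbv P x ≤ ε →
      ∃ h : x ∈ P.1, (⟨x, h⟩ : P.1) ∈ IsLocalRing.maximalIdeal P.1 ^ k := by
  obtain ⟨ϖ, hϖ⟩ := IsDiscreteValuationRing.exists_irreducible P.1
  have h0 : (ϖ : K) ≠ 0 := fun h => hϖ.ne_zero (Subtype.ext h)
  have hpos := (pointAbv P).pos (pow_ne_zero k h0)
  refine ⟨_, hpos, fun x hx => ?_⟩
  have h1 : x / (ϖ : K) ^ k ∈ P.1 := by
    rw [← pointAbv_le_one_iff, map_div₀]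
    exact (div_le_one hpos).mpr hx
  have h2 : x = ((⟨_, h1⟩ * ϖ ^ k : P.1) : K) := by
    simp [div_mul_cancel₀ _ (pow_ne_zero k h0)]
  refine ⟨h2 ▸ Subtype.property _, ?_⟩
  have h3 : (⟨x, h2 ▸ Subtype.property _⟩ : P.1) = ⟨_, h1⟩ * ϖ ^ k := Subtype.ext h2
  rw [h3]
  exact Ideal.mul_mem_left _ _ (Ideal.pow_mem_pow
    ((IsLocalRing.mem_maximalIdeal _).mpr hϖ.not_isUnit) k)

/-- Weak approximation for finitely many closed points. -/
theorem exists_forall_sub_mem_pow {ι : Type*} [Finite ι] {P : ι → ClosedPoint K}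
    (hP : Function.Injective P) (k : ι → ℕ) (a : ∀ i, (P i).1) :
    ∃ x : K, ∀ i, ∃ h : x ∈ (P i).1,
      (⟨x, h⟩ - a i : (P i).1) ∈ IsLocalRing.maximalIdeal (P i).1 ^ k i := by
  have := Fintype.ofFinite ι
  choose ε hε hmem using fun i => exists_pos_forall_mem_pow (P i) (k i)
  -- The common radius is the inverse of a bound for all `(ε i)⁻¹`; the maximum with `1` keeps it
  -- positive even for empty `ι`.
  obtain ⟨δ, hδ, hδε⟩ : ∃ δ : ℝ, 0 < δ ∧ ∀ i, δ ≤ ε i := by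
    obtain ⟨δ, h⟩ := Finite.exists_le (fun i => (ε i)⁻¹)
    refine ⟨(max δ 1)⁻¹, by positivity, fun i => ?_⟩
    rw [inv_le_comm₀ (by positivity) (hε i)]
    exact (h i).trans (le_max_left _ _)
  have hd := AbsoluteValue.denseRange_algebraMap_pi (v := fun i => pointAbv (P i))
    (fun i => pointAbv_isNontrivial _) (fun i j hij => not_isEquiv_pointAbv (hP.ne hij))
  obtain ⟨x, hx⟩ := Metric.denseRange_iff.mp hd
    (fun i => WithAbs.toAbs (pointAbv (P i)) (a i : K)) δ hδ
  refine ⟨x, fun i => ?_⟩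
  have h1 := (dist_pi_le_iff hδ.le).1 hx.le i
  have h2 : pointAbv (P i) (x - a i) ≤ ε i := by
    refine le_trans ?_ (hδε i)
    rw [dist_comm, dist_eq_norm] at h1
    exact h1
  obtain ⟨hm, hm'⟩ := hmem i _ h2
  have hxm : x ∈ (P i).1 := by
    have := (P i).1.add_mem _ _ hm (a i).2
    rwa [sub_add_cancel] at this
  exact ⟨hxm, hm'⟩

/-! ### Multiplicativity of the norm and of the Euler function -/

/-- Chinese remainder theorem: an element approximating local representatives is integral at every
point of the support, hence lies in `𝒪_D`; the kernel is `I_D` by construction. -/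
theorem divisorRing_quotient_equiv (D : EffDivisor K) :
    Nonempty ((divisorRing D ⧸ divisorIdeal D) ≃+*
      ((P : D.support) → P.1.1 ⧸ (IsLocalRing.maximalIdeal P.1.1) ^ (D P.1))) := by
  let f : divisorRing D →+* ((P : D.support) → P.1.1 ⧸ (IsLocalRing.maximalIdeal P.1.1) ^ (D P.1)) :=
    RingHom.pi fun P => (Ideal.Quotient.mk _).comp (toLocalRing D P)
  have hf : Function.Surjective f := by
    intro y
    choose a ha using fun P => Ideal.Quotient.mk_surjective (y P)
    obtain ⟨x, hx⟩ := exists_forall_sub_mem_pow (P := fun P : D.support => P.1)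
      Subtype.val_injective (fun P => D P.1) a
    have hxD : x ∈ divisorRing D := by
      rw [divisorRing, Subring.mem_iInf]
      exact fun P => (hx P).1
    refine ⟨⟨x, hxD⟩, funext fun P => ?_⟩
    rw [← ha P]
    exact Ideal.Quotient.eq.mpr (hx P).2
  have hker : RingHom.ker f = divisorIdeal D := by
    ext x
    simp only [RingHom.mem_ker, divisorIdeal, Ideal.mem_iInf, Ideal.mem_comap, funext_iff]
    exact forall_congr' fun P => Ideal.Quotient.eq_zero_iff_mem
  exact ⟨(Ideal.quotEquivOfEq hker.symm).trans (RingHom.quotientKerEquivOfSurjective hf)⟩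

/-- The cardinality of the residue field at `P`. -/
def residueCard (P : ClosedPoint K) : ℕ := Nat.card (P.1 ⧸ IsLocalRing.maximalIdeal P.1)

theorem card_quotient_pow (P : ClosedPoint K) (k : ℕ) :
    Nat.card (P.1 ⧸ IsLocalRing.maximalIdeal P.1 ^ k) = residueCard P ^ k :=
  cardQuot_pow_of_prime (IsDiscreteValuationRing.not_a_field P.1)

/-- The nonunits form the image of `𝔪_P`, of size `q ^ k`, among `q ^ (k + 1)` elements. As
`Nat.card` is `0` on infinite types, `hP` says that the residue field is finite. -/
theorem card_units_quotient_pow (P : ClosedPoint K) (hP : residueCard P ≠ 0) (k : ℕ) :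
    Nat.card (P.1 ⧸ IsLocalRing.maximalIdeal P.1 ^ (k + 1))ˣ =
      residueCard P ^ k * (residueCard P - 1) := by
  classical
  set m := IsLocalRing.maximalIdeal P.1
  have hle : m ^ (k + 1) ≤ m := Ideal.pow_le_self k.succ_ne_zero
  have hcard := card_quotient_pow P (k + 1)
  have hne : Nat.card (P.1 ⧸ m ^ (k + 1)) ≠ 0 := by rw [hcard]; exact pow_ne_zero _ hP
  have := Nat.finite_of_card_ne_zero hne
  -- Multiplicativity of indices: `#(m / m ^ (k + 1)) * q = q ^ (k + 1)`.
  have hmul := Submodule.card_quotient_mul_card_quotient m (m ^ (k + 1)) hle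
  rw [hcard, show Nat.card (P.1 ⧸ m) = residueCard P from rfl,
    pow_succ (residueCard P)] at hmul
  have hmap := Nat.eq_of_mul_eq_mul_right (Nat.pos_of_ne_zero hP) hmul
  have hun : ∀ x : P.1 ⧸ m ^ (k + 1), IsUnit x ↔ x ∉ Submodule.map (m ^ (k + 1)).mkQ m := by
    intro x
    obtain ⟨a, rfl⟩ := Ideal.Quotient.mk_surjective x
    have h1 : Ideal.Quotient.mk (m ^ (k + 1)) a ∈ Submodule.map (m ^ (k + 1)).mkQ m ↔ a ∈ m := by
      constructor
      · rintro ⟨b, hb, hab⟩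
        have := hle (Ideal.Quotient.eq.mp hab)
        have h2 := m.sub_mem hb this
        rwa [sub_sub_cancel] at h2
      · exact fun h => ⟨a, h, rfl⟩
    rw [h1]
    constructor
    · intro hu ha
      obtain ⟨y, hy⟩ := hu.exists_right_inv
      obtain ⟨b, rfl⟩ := Ideal.Quotient.mk_surjective y
      rw [← map_mul, ← map_one (Ideal.Quotient.mk _), Ideal.Quotient.eq] at hy
      have h2 := m.sub_mem (m.mul_mem_right b ha) (hle hy)
      rw [sub_sub_cancel] at h2
      exact (IsLocalRing.maximalIdeal.isMaximal P.1).ne_top ((Ideal.eq_top_iff_one _).mpr h2)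
    · intro ha
      have : IsUnit a := by
        by_contra h
        exact ha ((IsLocalRing.mem_maximalIdeal _).mpr h)
      exact this.map _
  have e : (P.1 ⧸ m ^ (k + 1))ˣ ≃ {x // ¬ x ∈ Submodule.map (m ^ (k + 1)).mkQ m} :=
    
    (Equiv.ofBijective (fun u : (P.1 ⧸ m ^ (k + 1))ˣ =>
      (⟨u, u.isUnit⟩ : {x : P.1 ⧸ m ^ (k + 1) // IsUnit x}))
      ⟨fun u v h => Units.ext (congrArg Subtype.val h), fun x => ⟨x.2.unit, Subtype.ext rfl⟩⟩).trans
      (Equiv.subtypeEquivRight hun)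
  have hsum := Nat.card_congr (Equiv.sumCompl (fun x => x ∈ Submodule.map (m ^ (k + 1)).mkQ m))
  rw [Nat.card_sum, hcard, ← Nat.card_congr e] at hsum
  have hmap' : Nat.card {x // x ∈ Submodule.map (m ^ (k + 1)).mkQ m} = residueCard P ^ k := hmap
  rw [hmap', pow_succ (residueCard P)] at hsum
  rw [Nat.mul_sub, mul_one]
  exact Nat.eq_sub_of_add_eq' hsum

theorem norm_eq_prod (D : EffDivisor K) : norm D = D.prod fun P k => residueCard P ^ k := by
  by_cases h : D = 0
  · simp [h, norm]
  obtain ⟨e⟩ := divisorRing_quotient_equiv D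
  rw [norm, if_neg h, Nat.card_congr e.toEquiv, Nat.card_pi, Finsupp.prod,
    ← Finset.prod_coe_sort D.support]
  exact Finset.prod_congr rfl fun P _ => card_quotient_pow _ _

theorem pointNorm_eq (P : ClosedPoint K) : pointNorm P = residueCard P := by
  simp [pointNorm, norm_eq_prod]

theorem norm_eq_prod_pointNorm (D : EffDivisor K) : norm D = D.prod fun P k => pointNorm P ^ k := by
  simp only [norm_eq_prod D, pointNorm_eq]

/-- The truncated `k - 1` is harmless, as `k ≥ 1` on the support. -/
theorem euler_eq_prod (hK : ∀ P : ClosedPoint K, pointNorm P ≠ 0) (D : EffDivisor K) :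
    euler D = D.prod fun P k => pointNorm P ^ (k - 1) * (pointNorm P - 1) := by
  by_cases h : D = 0
  · simp [h, euler]
  obtain ⟨e⟩ := divisorRing_quotient_equiv D
  rw [euler, if_neg h, Nat.card_congr ((Units.mapEquiv e.toMulEquiv).trans MulEquiv.piUnits).toEquiv,
    Nat.card_pi, Finsupp.prod, ← Finset.prod_coe_sort D.support]
  refine Finset.prod_congr rfl fun P _ => ?_
  obtain ⟨k, hk⟩ := Nat.exists_eq_succ_of_ne_zero (Finsupp.mem_support_iff.mp P.2)
  have := hK P.1
  rw [pointNorm_eq] at this ⊢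
  rw [hk]
  exact card_units_quotient_pow P.1 this k

/-- Grouping a finite sum by the fibres of `f` bounds it by `∑ c k * h k`. It serves for points over
their centers and for ideals of `F[X]` by degree. -/
theorem summable_of_card_fiber_le {ι κ : Type*} (f : ι → κ) {c h : κ → ℝ} {g : ι → ℝ}
    (hc : ∀ k, ∀ S : Finset ι, (∀ i ∈ S, f i = k) → (S.card : ℝ) ≤ c k)
    (hg : ∀ i, 0 ≤ g i) (hh : ∀ k, 0 ≤ h k) (hgh : ∀ i, g i ≤ h (f i))
    (hs : Summable fun k => c k * h k) : Summable g := by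
  classical
  have hc0 : ∀ k, 0 ≤ c k := fun k => by simpa using hc k ∅ (by simp)
  refine summable_of_sum_le hg (c := ∑' k, c k * h k) fun S => ?_
  rw [← Finset.sum_fiberwise_of_maps_to (t := S.image f) (g := f)
    (fun i hi => Finset.mem_image_of_mem f hi)]
  refine le_trans (Finset.sum_le_sum fun k _ => ?_)
    (hs.sum_le_tsum _ fun k _ => mul_nonneg (hc0 k) (hh k))
  refine le_trans (Finset.sum_le_card_nsmul _ _ (h k) fun i hi => ?_) ?_
  · rw [← (Finset.mem_filter.mp hi).2]
    exact hgh i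
  · rw [nsmul_eq_mul]
    exact mul_le_mul_of_nonneg_right (hc k _ fun i hi => (Finset.mem_filter.mp hi).2) (hh k)

/-! ### Closed points over a principal ideal domain -/

section Center

variable {R : Type*} [CommRing R] [Algebra R K]

/-- The map from `R` to the local ring at `P`, if the latter contains the image of `R`. -/
def toPoint (P : ClosedPoint K) (h : ∀ r : R, algebraMap R K r ∈ P.1) : R →+* P.1 :=
  (algebraMap R K).codRestrict P.1.toSubring h

/-- The center of `P` on `R`. -/
def center (P : ClosedPoint K) (h : ∀ r : R, algebraMap R K r ∈ P.1) : Ideal R :=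
  (IsLocalRing.maximalIdeal P.1).comap (toPoint P h)

theorem center_isPrime (P : ClosedPoint K) (h : ∀ r : R, algebraMap R K r ∈ P.1) :
    (center P h).IsPrime := Ideal.comap_isPrime _ _

theorem mem_center_iff {P : ClosedPoint K} {h : ∀ r : R, algebraMap R K r ∈ P.1} {r : R} :
    r ∈ center P h ↔ Ideal.Quotient.mk (IsLocalRing.maximalIdeal P.1) (toPoint P h r) = 0 := by
  rw [Ideal.Quotient.eq_zero_iff_mem]
  rfl

/-- A uniformizer is a nonzero root of a nonzero polynomial over `R`. After cancelling powers of the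
variable, the constant term is nonzero and lies in `𝔪_P`. -/
theorem center_ne_bot [FaithfulSMul R K] [Algebra.IsAlgebraic R K] (P : ClosedPoint K)
    (h : ∀ r : R, algebraMap R K r ∈ P.1) : center P h ≠ ⊥ := by
  let _ : Algebra R P.1 := (toPoint P h).toAlgebra
  obtain ⟨ϖ, hϖ⟩ := IsDiscreteValuationRing.exists_irreducible P.1
  refine Ideal.comap_ne_bot_of_algebraic_mem (S := P.1) hϖ.ne_zero
    ((IsLocalRing.mem_maximalIdeal _).mpr hϖ.not_isUnit) ?_
  obtain ⟨p, hp0, hp⟩ := Algebra.IsAlgebraic.isAlgebraic (R := R) (ϖ : K)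
  refine ⟨p, hp0, Subtype.ext ?_⟩
  have : IsScalarTower R P.1 K := IsScalarTower.of_algebraMap_eq fun _ => rfl
  have h2 := Polynomial.aeval_algebraMap_apply K ϖ p
  exact h2.symm.trans hp

theorem card_quotient_center_le (P : ClosedPoint K) (h : ∀ r : R, algebraMap R K r ∈ P.1)
    (hf : Finite (P.1 ⧸ IsLocalRing.maximalIdeal P.1)) :
    Nat.card (R ⧸ center P h) ≤ pointNorm P := by
  rw [pointNorm_eq]
  exact Nat.card_le_card_of_injective
    (Ideal.quotientMap (IsLocalRing.maximalIdeal P.1) (toPoint P h) le_rfl)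
    Ideal.quotientMap_injective

theorem two_le_pointNorm_of_finite (P : ClosedPoint K)
    (hf : Finite (P.1 ⧸ IsLocalRing.maximalIdeal P.1)) : 2 ≤ pointNorm P := by
  rw [pointNorm_eq]
  have : Nontrivial (P.1 ⧸ IsLocalRing.maximalIdeal P.1) :=
    Ideal.Quotient.nontrivial_iff.mpr (IsLocalRing.maximalIdeal.isMaximal P.1).ne_top
  exact Finite.one_lt_card

variable [IsDomain R] [IsPrincipalIdealRing R]

/-- A linear relation over a principal ideal domain may be taken nontrivial modulo `p`. -/
theorem exists_relation_not_mem [FaithfulSMul R K] {p : Ideal R} (hp : p ≠ ⊤) {m : ℕ}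
    {x : Fin m → K} (hx : ¬ LinearIndependent R x) :
    ∃ c : Fin m → R, ∑ i, algebraMap R K (c i) * x i = 0 ∧ ∃ i, c i ∉ p := by
  classical
  obtain ⟨g, hg, i, hi⟩ := Fintype.not_linearIndependent_iff.mp hx
  let _ : StrongNormalizationMonoid R := UniqueFactorizationMonoid.strongNormalizationMonoid
  let _ : NormalizedGCDMonoid R := UniqueFactorizationMonoid.toNormalizedGCDMonoid R
  -- Once divided by their gcd, the coefficients have gcd `1`, so the generator of a proper ideal
  -- cannot divide them all.
  obtain ⟨c, hc, h1⟩ := Finset.extract_gcd g (s := Finset.univ) ⟨i, Finset.mem_univ i⟩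
  have hd : Finset.univ.gcd g ≠ 0 := fun h0 => hi (by rw [hc i (Finset.mem_univ i), h0, zero_mul])
  refine ⟨c, ?_, ?_⟩
  · have h2 : algebraMap R K (Finset.univ.gcd g) * ∑ i, algebraMap R K (c i) * x i = 0 := by
      rw [← hg, Finset.mul_sum]
      refine Finset.sum_congr rfl fun j hj => ?_
      rw [Algebra.smul_def, hc j hj, map_mul, mul_assoc]
    refine (mul_eq_zero.mp h2).resolve_left fun h0 => hd ?_
    exact FaithfulSMul.algebraMap_injective R K (h0.trans (map_zero _).symm)
  · by_contra! hall
    apply hp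
    have h3 : Submodule.IsPrincipal.generator p ∣ 1 := by
      rw [← h1]
      exact Finset.dvd_gcd fun j _ => (Submodule.IsPrincipal.mem_iff_generator_dvd p).mp (hall j)
    exact (Ideal.eq_top_iff_one p).mpr ((Submodule.IsPrincipal.mem_iff_generator_dvd p).mpr h3)

/-- At most `n` closed points of an extension of rank at most `n` have a given center. -/
theorem card_le_of_center_eq [FaithfulSMul R K] {n : ℕ}
    (hn : ∀ (m : ℕ) (v : Fin m → K), LinearIndependent R v → m ≤ n) {p : Ideal R} {m : ℕ}
    {P : Fin m → ClosedPoint K} (hP : Function.Injective P)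
    (h : ∀ i, ∀ r : R, algebraMap R K r ∈ (P i).1) (hc : ∀ i, center (P i) (h i) = p) :
    m ≤ n := by
  classical
  -- `x i` is `1` modulo the maximal ideal at `P i` and `0` at the other points. Reducing a relation
  -- among the `x j` at `P i` isolates its `i`-th coefficient, which must lie in `p`.
  choose x hx using fun i => exists_forall_sub_mem_pow hP (fun _ => 1)
    (fun j => if i = j then (1 : (P j).1) else 0)
  refine hn m x ?_
  by_contra hli
  have hp : p ≠ ⊤ := by
    rcases m with - | m
    · exact absurd linearIndependent_empty_type hli
    · rw [← hc 0]
      exact (center_isPrime (P 0) (h 0)).ne_top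
  obtain ⟨c, hsum, i, hi⟩ := exists_relation_not_mem hp hli
  apply hi
  rw [← hc i, mem_center_iff]
  have h1 : ∑ j, toPoint (P i) (h i) (c j) * ⟨x j, (hx j i).1⟩ = (0 : (P i).1) := by
    apply Subtype.ext
    have : ((∑ j, toPoint (P i) (h i) (c j) * ⟨x j, (hx j i).1⟩ : (P i).1) : K) =
        ∑ j, algebraMap R K (c j) * x j := by
      rw [← ValuationSubring.subtype_apply, map_sum]
      rfl
    exact this.trans hsum
  have h2 : ∀ j, Ideal.Quotient.mk (IsLocalRing.maximalIdeal (P i).1) ⟨x j, (hx j i).1⟩ =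
      if j = i then 1 else 0 := by
    intro j
    have := (hx j i).2
    rw [pow_one, ← Ideal.Quotient.eq] at this
    rw [this]
    split_ifs <;> simp
  have h3 := congrArg (Ideal.Quotient.mk (IsLocalRing.maximalIdeal (P i).1)) h1
  simpa [h2] using h3

/-- The residue field at `P` is finite if the residue ring of its center is. -/
theorem finite_residue [FaithfulSMul R K] {n : ℕ}
    (hn : ∀ (m : ℕ) (v : Fin m → K), LinearIndependent R v → m ≤ n) (P : ClosedPoint K)
    (h : ∀ r : R, algebraMap R K r ∈ P.1) (hb : center P h ≠ ⊥) (hf : Finite (R ⧸ center P h)) :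
    Finite (P.1 ⧸ IsLocalRing.maximalIdeal P.1) := by
  classical
  have := center_isPrime P h
  have := IsPrime.to_maximal_ideal hb
  let _ : Field (R ⧸ center P h) := Ideal.Quotient.field _
  let _ : Algebra (R ⧸ center P h) (P.1 ⧸ IsLocalRing.maximalIdeal P.1) :=
    (Ideal.quotientMap (IsLocalRing.maximalIdeal P.1) (toPoint P h) le_rfl).toAlgebra
  -- Lifts of independent residues stay independent over `R`: a relation with a coefficient outside
  -- the center would reduce to a nontrivial one.
  have hrank : Module.rank (R ⧸ center P h) (P.1 ⧸ IsLocalRing.maximalIdeal P.1) ≤ n := by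
    refine rank_le fun s hs => ?_
    have hs' : LinearIndependent (R ⧸ center P h)
        (fun i : Fin s.card => (s.equivFin.symm i : P.1 ⧸ IsLocalRing.maximalIdeal P.1)) :=
      hs.comp _ s.equivFin.symm.injective
    choose a ha using fun i : Fin s.card =>
      Ideal.Quotient.mk_surjective (s.equivFin.symm i : P.1 ⧸ IsLocalRing.maximalIdeal P.1)
    refine hn _ (fun i => (a i : K)) ?_
    by_contra hli
    obtain ⟨c, hsum, i, hi⟩ := exists_relation_not_mem (center_isPrime P h).ne_top hli
    apply hi
    have h1 : ∑ j, toPoint P h (c j) * a j = (0 : P.1) := by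
      apply Subtype.ext
      have : ((∑ j, toPoint P h (c j) * a j : P.1) : K) = ∑ j, algebraMap R K (c j) * a j := by
        rw [← ValuationSubring.subtype_apply, map_sum]
        rfl
      exact this.trans hsum
    have h3 := congrArg (Ideal.Quotient.mk (IsLocalRing.maximalIdeal P.1)) h1
    rw [map_sum, map_zero] at h3
    refine Ideal.Quotient.eq_zero_iff_mem.mp (Fintype.linearIndependent_iff.mp hs'
      (fun j => Ideal.Quotient.mk _ (c j)) (Eq.trans (Finset.sum_congr rfl fun j _ => ?_) h3) i)
    rw [map_mul, ha, Algebra.smul_def]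
    rfl
  have : Module.Finite (R ⧸ center P h) (P.1 ⧸ IsLocalRing.maximalIdeal P.1) :=
    Module.rank_lt_aleph0_iff.mp (hrank.trans_lt (Cardinal.natCast_lt_aleph0))
  exact Module.finite_of_finite (R ⧸ center P h)

/-- Each ideal is the center of at most `n` points, and `R / p` embeds in the residue field. Summing
over all nonzero ideals instead of primes only enlarges the bound. -/
theorem summable_pointNorm_of_contains [FaithfulSMul R K] [Algebra.IsAlgebraic R K] {n : ℕ}
    (hn : ∀ (m : ℕ) (v : Fin m → K), LinearIndependent R v → m ≤ n)
    (hf : ∀ p : Ideal R, p ≠ ⊥ → Finite (R ⧸ p)) {σ : ℝ} (hσ : 0 ≤ σ)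
    (hs : Summable fun p : {p : Ideal R // p ≠ ⊥} => (Nat.card (R ⧸ p.1) : ℝ) ^ (-σ)) :
    Summable fun P : {P : ClosedPoint K // ∀ r : R, algebraMap R K r ∈ P.1} =>
      (pointNorm P.1 : ℝ) ^ (-σ) := by
  classical
  refine summable_of_card_fiber_le (c := fun _ => (n : ℝ))
    (f := fun P => (⟨center P.1 P.2, center_ne_bot _ _⟩ : {p : Ideal R // p ≠ ⊥}))
    ?_ (fun _ => by positivity) (fun _ => by positivity) ?_ (hs.mul_left _)
  · intro p S hS
    rw [Nat.cast_le]
    exact card_le_of_center_eq hn (p := p.1) (P := fun i => (S.equivFin.symm i).1.1)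
      (fun i j hij => S.equivFin.symm.injective (Subtype.ext (Subtype.ext hij)))
      (fun i => (S.equivFin.symm i).1.2)
      (fun i => congrArg Subtype.val (hS _ (S.equivFin.symm i).2))
  · intro P
    have h1 := hf _ (center_ne_bot P.1 P.2)
    refine Real.rpow_le_rpow_of_nonpos ?_ ?_ (by linarith)
    · exact_mod_cast Nat.card_pos
    · exact_mod_cast card_quotient_center_le P.1 P.2
        (finite_residue hn P.1 P.2 (center_ne_bot _ _) h1)

end Center

/-! ### Sums over the ideals of `ℤ` and `F[X]` -/

/-- An ideal of `ℤ` is determined by its index, so this is a subseries of `∑ n^{-σ}`. -/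
theorem summable_card_int_quotient {σ : ℝ} (hσ : 1 < σ) :
    Summable fun p : {p : Ideal ℤ // p ≠ ⊥} => (Nat.card (ℤ ⧸ p.1) : ℝ) ^ (-σ) := by
  have hinj : Function.Injective fun p : {p : Ideal ℤ // p ≠ ⊥} => Nat.card (ℤ ⧸ p.1) := by
    have key : ∀ p : Ideal ℤ, p = Ideal.span {(Nat.card (ℤ ⧸ p) : ℤ)} := by
      intro p
      obtain ⟨a, rfl⟩ := (IsPrincipalIdealRing.principal p).principal
      have : Nat.card (ℤ ⧸ Ideal.span {a}) = a.natAbs := by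
        rw [← Int.span_natAbs]
        exact Int.card_ideal_quot a.natAbs
      rw [Ideal.submodule_span_eq, this, Int.span_natAbs]
    intro p q h
    apply Subtype.ext
    rw [key p.1, key q.1]
    exact congrArg (fun n : ℕ => Ideal.span {(n : ℤ)}) h
  exact (Real.summable_nat_rpow.mpr (by linarith : -σ < -1)).comp_injective hinj

theorem finite_quotient_polynomial {F : Type*} [Field F] [Finite F] (p : Ideal (Polynomial F))
    (hp : p ≠ ⊥) : Finite (Polynomial F ⧸ p) := by
  obtain ⟨f, rfl⟩ := (IsPrincipalIdealRing.principal p).principal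
  have hf : f ≠ 0 := by
    rintro rfl
    simp at hp
  have : Module.Finite F (AdjoinRoot f) := (AdjoinRoot.powerBasis hf).finite
  exact Module.finite_of_finite F (M := AdjoinRoot f)

/-- A generator of degree `d` gives index `q ^ d`, where `q = #F`. The crude count `q ^ (d + 1)` of
polynomials of degree at most `d` already leaves a geometric series of ratio `q ^ (1 - σ) < 1`. -/
theorem summable_card_polynomial_quotient {F : Type*} [Field F] [Finite F] {σ : ℝ} (hσ : 1 < σ) :
    Summable fun p : {p : Ideal (Polynomial F) // p ≠ ⊥} =>
      (Nat.card (Polynomial F ⧸ p.1) : ℝ) ^ (-σ) := by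
  classical
  set q : ℕ := Nat.card F with hq
  have hq1 : 1 < q := Finite.one_lt_card
  have hq0 : (0 : ℝ) < q := by positivity
  let gen : {p : Ideal (Polynomial F) // p ≠ ⊥} → Polynomial F :=
    fun p => Submodule.IsPrincipal.generator p.1
  have hgen : ∀ p, Ideal.span {gen p} = p.1 := fun p => Ideal.span_singleton_generator p.1
  refine summable_of_card_fiber_le (f := fun p => (gen p).natDegree)
    (c := fun d => (q : ℝ) ^ (d + 1)) (h := fun d => ((q : ℝ) ^ d) ^ (-σ))
    ?_ (fun _ => by positivity) (fun _ => by positivity) ?_ ?_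
  · intro d S hS
    have hmem : ∀ p ∈ S, gen p ∈ Polynomial.degreeLT F (d + 1) := by
      intro p hp
      rw [Polynomial.mem_degreeLT]
      refine Polynomial.degree_le_natDegree.trans_lt ?_
      rw [hS p hp]
      exact_mod_cast Nat.lt_succ_self d
    let e : S → (Fin (d + 1) → F) := fun p =>
      Polynomial.degreeLTEquiv F (d + 1) ⟨gen p.1, hmem p.1 p.2⟩
    have he : Function.Injective e := by
      intro p p' h
      have h1 := congrArg Subtype.val ((Polynomial.degreeLTEquiv F (d + 1)).injective h)
      apply Subtype.ext
      apply Subtype.ext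
      rw [← hgen, ← hgen]
      exact congrArg (fun f => Ideal.span {f}) h1
    have h2 := Nat.card_le_card_of_injective e he
    rw [Nat.card_eq_finsetCard, Nat.card_fun, Nat.card_fin] at h2
    exact_mod_cast h2
  · intro p
    have h0 : gen p ≠ 0 := by
      intro h
      apply p.2
      rw [← hgen, h]
      simp
    have : Nat.card (Polynomial F ⧸ p.1) = q ^ (gen p).natDegree := by
      rw [← hgen p]
      rw [← finrank_quotient_span_eq_natDegree (K := F) (f := gen p)]
      have : Module.Finite F (AdjoinRoot (gen p)) := (AdjoinRoot.powerBasis h0).finite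
      exact Module.natCard_eq_pow_finrank (K := F) (V := AdjoinRoot (gen p))
    rw [this]
    push_cast
    exact le_rfl
  · have h1 : ∀ d : ℕ, (q : ℝ) ^ (d + 1) * ((q : ℝ) ^ d) ^ (-σ) = q * ((q : ℝ) ^ (1 - σ)) ^ d := by
      intro d
      rw [pow_succ, mul_comm _ (q : ℝ), mul_assoc, ← Real.rpow_natCast ((q : ℝ) ^ (1 - σ)),
        ← Real.rpow_mul hq0.le, ← Real.rpow_natCast, ← Real.rpow_mul hq0.le,
        ← Real.rpow_add hq0]
      ring_nf
    simp_rw [h1]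
    refine (summable_geometric_of_lt_one (by positivity) ?_).mul_left _
    exact Real.rpow_lt_one_of_one_lt_of_neg (by exact_mod_cast hq1) (by linarith)

/-- Clearing denominators, independence over `R` is independence over its fraction field. -/
theorem le_finrank_of_linearIndependent {R : Type*} (E : Type*) [CommRing R] [IsDomain R] [Field E]
    [Algebra R K] [Algebra R E] [Algebra E K] [IsScalarTower R E K] [IsFractionRing R E]
    [FiniteDimensional E K] (m : ℕ) (v : Fin m → K) (hv : LinearIndependent R v) :
    m ≤ Module.finrank E K := by
  have h := (LinearIndependent.iff_fractionRing R E).mp hv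
  simpa using h.fintype_card_le_finrank

/-! ### Number fields, over `ℤ` -/

section NumberField

theorem isAlgebraic_int [NumberField K] : Algebra.IsAlgebraic ℤ K :=
  (IsFractionRing.comap_isAlgebraic_iff (A := ℤ) (K := ℚ) (C := K)).mpr inferInstance

theorem algebraMap_int_mem (P : ClosedPoint K) (r : ℤ) : algebraMap ℤ K r ∈ P.1 := by
  rw [eq_intCast]
  exact intCast_mem P.1 r

variable [NumberField K]

theorem finite_residue_of_numberField (P : ClosedPoint K) :
    Finite (P.1 ⧸ IsLocalRing.maximalIdeal P.1) := by
  have := isAlgebraic_int (K := K)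
  have hb := center_ne_bot P (algebraMap_int_mem P)
  exact finite_residue (le_finrank_of_linearIndependent (R := ℤ) ℚ) P (algebraMap_int_mem P) hb
    (Ideal.finiteQuotientOfFreeOfNeBot _ hb)

theorem summable_pointNorm_of_numberField {σ : ℝ} (hσ : 1 < σ) :
    Summable fun P : ClosedPoint K => (pointNorm P : ℝ) ^ (-σ) := by
  have := isAlgebraic_int (K := K)
  have h := summable_pointNorm_of_contains (K := K) (R := ℤ) (le_finrank_of_linearIndependent (R := ℤ) ℚ)
    (fun p hp => Ideal.finiteQuotientOfFreeOfNeBot p hp) (by linarith)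
    (summable_card_int_quotient hσ)
  exact (Equiv.subtypeUnivEquiv algebraMap_int_mem).symm.summable_iff.mpr h

end NumberField

/-! ### Function fields, over `F[u]` -/

section FunctionField

open Polynomial IntermediateField

variable {F : Subfield K} {u : K}

/-- The `F[X]`-algebra structure on `K` with `X` acting as `u`. -/
abbrev polynomialAlgebra (F : Subfield K) (u : K) : Algebra F[X] K := (aeval u).toRingHom.toAlgebra

/-- Since `u` is transcendental, `F⟮u⟯` is the fraction field of `F[X]`. This supplies the
hypotheses on `R = F[X]` used for centers. -/
theorem exists_bound_of_functionField (hu : Transcendental F u) [FiniteDimensional F⟮u⟯ K] :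
    letI := polynomialAlgebra F u
    FaithfulSMul F[X] K ∧ Algebra.IsAlgebraic F[X] K ∧
      ∀ (m : ℕ) (v : Fin m → K), LinearIndependent F[X] v → m ≤ Module.finrank F⟮u⟯ K := by
  let _ := polynomialAlgebra F u
  have hinj : Function.Injective (algebraMap F[X] K) := transcendental_iff_injective.mp hu
  let g : F[X] →+* F⟮u⟯ := (aeval u).toRingHom.codRestrict F⟮u⟯.toSubfield.toSubring
    fun p => (mem_adjoin_simple_iff F _).mpr ⟨p, 1, by simp⟩
  let _ : Algebra F[X] F⟮u⟯ := g.toAlgebra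
  have : IsScalarTower F[X] F⟮u⟯ K := IsScalarTower.of_algebraMap_eq fun _ => rfl
  have : FaithfulSMul F[X] K := (faithfulSMul_iff_algebraMap_injective _ _).mpr hinj
  have : FaithfulSMul F[X] F⟮u⟯ := (faithfulSMul_iff_algebraMap_injective _ _).mpr
    fun a b h => hinj (congrArg Subtype.val h)
  have : IsFractionRing F[X] F⟮u⟯ := by
    refine IsFractionRing.of_field _ _ fun z => ?_
    obtain ⟨r, s, hz⟩ := (mem_adjoin_simple_iff F _).mp z.2
    exact ⟨r, s, Subtype.ext hz⟩
  refine ⟨inferInstance,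
    (IsFractionRing.comap_isAlgebraic_iff (A := F[X]) (K := F⟮u⟯) (C := K)).mpr inferInstance,
    le_finrank_of_linearIndependent F⟮u⟯⟩

variable [Finite F]

theorem aeval_mem (P : ClosedPoint K) (hP : u ∈ P.1) (r : F[X]) : aeval u r ∈ P.1 := by
  rw [aeval_eq_sum_range]
  refine sum_mem fun i _ => ?_
  rw [Algebra.smul_def]
  exact mul_mem (subfield_le_valuationSubring F P.1 (r.coeff i).2) (pow_mem hP i)

theorem finite_residue_of_mem (hu : Transcendental F u) [FiniteDimensional F⟮u⟯ K]
    (P : ClosedPoint K) (hP : u ∈ P.1) : Finite (P.1 ⧸ IsLocalRing.maximalIdeal P.1) := by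
  let _ := polynomialAlgebra F u
  obtain ⟨_, _, hn⟩ := exists_bound_of_functionField hu
  have hb := center_ne_bot (R := F[X]) P (aeval_mem P hP)
  exact finite_residue hn P (aeval_mem P hP) hb (finite_quotient_polynomial _ hb)

theorem summable_pointNorm_of_mem (hu : Transcendental F u) [FiniteDimensional F⟮u⟯ K]
    {σ : ℝ} (hσ : 1 < σ) :
    Summable fun P : {P : ClosedPoint K // u ∈ P.1} => (pointNorm P.1 : ℝ) ^ (-σ) := by
  let _ := polynomialAlgebra F u
  obtain ⟨_, _, hn⟩ := exists_bound_of_functionField hu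
  have hs : Summable fun p : {p : Ideal F[X] // p ≠ ⊥} => (Nat.card (F[X] ⧸ p.1) : ℝ) ^ (-σ) :=
    summable_card_polynomial_quotient hσ
  have hf : ∀ p : Ideal F[X], p ≠ ⊥ → Finite (F[X] ⧸ p) := finite_quotient_polynomial
  have hσ0 : 0 ≤ σ := by linarith
  have h := summable_pointNorm_of_contains (K := K) (R := F[X]) hn hf hσ0 hs
  let i : {P : ClosedPoint K // u ∈ P.1} →
      {P : ClosedPoint K // ∀ r : F[X], algebraMap F[X] K r ∈ P.1} :=
    fun P => ⟨P.1, aeval_mem P.1 P.2⟩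
  have hi : Function.Injective i := fun P Q hPQ => by
      have h3 : (i P).1 = (i Q).1 := by rw [hPQ]
      exact Subtype.ext h3
  have h4 := h.comp_injective hi
  exact h4

end FunctionField

open IntermediateField in
theorem finite_residue_and_summable (hK : IsGlobalField K) :
    (∀ P : ClosedPoint K, Finite (P.1 ⧸ IsLocalRing.maximalIdeal P.1)) ∧
      ∀ σ : ℝ, 1 < σ → Summable fun P : ClosedPoint K => (pointNorm P : ℝ) ^ (-σ) := by
  rcases hK with hK | ⟨F, hF, t, ht, hfin⟩
  · exact ⟨finite_residue_of_numberField, fun σ => summable_pointNorm_of_numberField⟩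
  -- Points at which `t` has a pole contain `t⁻¹`, which generates the same subfield and can play
  -- the role of `t`.
  have ht' : Transcendental F t⁻¹ := fun h => ht (by simpa using h.inv)
  have hadj : F⟮t⁻¹⟯ = F⟮t⟯ := by
    apply le_antisymm <;> rw [adjoin_simple_le_iff]
    · exact inv_mem (mem_adjoin_simple_self F t)
    · simpa using inv_mem (mem_adjoin_simple_self F t⁻¹)
  have hfin' : FiniteDimensional F⟮t⁻¹⟯ K := by
    rw [hadj]
    exact hfin
  refine ⟨fun P => ?_, fun σ hσ => ?_⟩
  · rcases P.1.mem_or_inv_mem t with h | h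
    · exact finite_residue_of_mem ht P h
    · exact finite_residue_of_mem ht' P h
  · have h1 := summable_pointNorm_of_mem (K := K) ht hσ
    have h2 := summable_pointNorm_of_mem (K := K) ht' hσ
    refine Summable.add_compl (s := {P : ClosedPoint K | t ∈ P.1}) h1 ?_
    let i : ↥({P : ClosedPoint K | t ∈ P.1}ᶜ) → {P : ClosedPoint K // t⁻¹ ∈ P.1} :=
      fun P => ⟨P.1, (P.1.1.mem_or_inv_mem t).resolve_left P.2⟩
    have hi : Function.Injective i := fun P Q hPQ => by
      have h3 : (i P).1 = (i Q).1 := by rw [hPQ]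
      exact Subtype.ext h3
    have h4 := h2.comp_injective hi
    exact h4

theorem summable_pointNorm (hK : IsGlobalField K) {σ : ℝ} (hσ : 1 < σ) :
    Summable fun P : ClosedPoint K => (pointNorm P : ℝ) ^ (-σ) :=
  (finite_residue_and_summable hK).2 σ hσ

theorem two_le_pointNorm (hK : IsGlobalField K) (P : ClosedPoint K) : 2 ≤ pointNorm P :=
  two_le_pointNorm_of_finite P ((finite_residue_and_summable hK).1 P)

/-! ### Euler products over finitely supported functions -/

section EulerProduct

variable {ι : Type*}

theorem sum_finsupp_prod {A : Type*} [CommSemiring A] {g : ι → ℕ → A} (h0 : ∀ i, g i 0 = 1)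
    (T : Finset ι) (N : ℕ) :
    ∑ D ∈ T.finsupp fun _ => Finset.range N, D.prod g = ∏ i ∈ T, ∑ k ∈ Finset.range N, g i k := by
  classical
  rw [Finset.prod_sum, Finset.finsupp, Finset.sum_map]
  refine Finset.sum_congr rfl fun p _ => ?_
  change (Finsupp.indicator T p).prod g = _
  rw [Finsupp.prod_of_support_subset _ (Finsupp.support_indicator_subset T p) _ fun i _ => h0 i,
    ← Finset.prod_attach]
  refine Finset.prod_congr rfl fun i _ => ?_
  simp

/-- Boxes (support in `T`, values below `N`) absorb every finite set of divisors; on a box the sum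
is a finite product of partial sums. -/
theorem exists_subset_finsupp (S : Finset (ι →₀ ℕ)) :
    ∃ (T : Finset ι) (N : ℕ), ∀ T' N', T ⊆ T' → N ≤ N' →
      S ⊆ T'.finsupp fun _ => Finset.range N' := by
  classical
  refine ⟨S.biUnion Finsupp.support, (S.sup fun D => D.support.sup D) + 1, fun T' N' hT hN D hD => ?_⟩
  have hs : D.support ⊆ T' := fun i hi => hT (Finset.mem_biUnion.mpr ⟨D, hD, hi⟩)
  refine Finset.mem_finsupp_iff.mpr ⟨hs, fun i _ => ?_⟩
  rw [Finset.mem_range]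
  by_cases hi : i ∈ D.support
  · have h1 : D i ≤ D.support.sup D := Finset.le_sup hi
    have h2 : D.support.sup D ≤ S.sup fun D => D.support.sup D :=
      Finset.le_sup (f := fun D : ι →₀ ℕ => D.support.sup D) hD
    omega
  · rw [Finsupp.notMem_support_iff.mp hi]
    omega

variable {g : ι → ℕ → ℂ}

theorem norm_finsupp_prod (g : ι → ℕ → ℂ) (D : ι →₀ ℕ) :
    ‖D.prod g‖ = D.prod fun i k => ‖g i k‖ := by
  simp [Finsupp.prod]

/-- Box sums are at most `∏ (1 + a_i) ≤ exp (∑ a_i)`, with `a_i` the sum of the norms of the terms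
of positive index. -/
theorem summable_norm_finsupp_prod (h0 : ∀ i, g i 0 = 1) (hs : ∀ i, Summable fun k => ‖g i k‖)
    (hsum : Summable fun i => ∑' k, ‖g i (k + 1)‖) :
    Summable fun D : ι →₀ ℕ => ‖D.prod g‖ := by
  refine summable_of_sum_le (fun _ => norm_nonneg _)
    (c := Real.exp (∑' i, ∑' k, ‖g i (k + 1)‖)) fun S => ?_
  obtain ⟨T, N, hTN⟩ := exists_subset_finsupp S
  refine (Finset.sum_le_sum_of_subset_of_nonneg (hTN T N subset_rfl le_rfl)
    fun _ _ _ => norm_nonneg _).trans ?_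
  simp_rw [norm_finsupp_prod]
  rw [sum_finsupp_prod (g := fun i k => ‖g i k‖) (by simp [h0])]
  have hnn : ∀ i, 0 ≤ ∑' k, ‖g i (k + 1)‖ := fun i => tsum_nonneg fun _ => norm_nonneg _
  calc ∏ i ∈ T, ∑ k ∈ Finset.range N, ‖g i k‖
      ≤ ∏ i ∈ T, Real.exp (∑' k, ‖g i (k + 1)‖) := by
        refine Finset.prod_le_prod (fun _ _ => Finset.sum_nonneg fun _ _ => norm_nonneg _)
          fun i _ => ?_
        refine ((hs i).sum_le_tsum _ fun _ _ => norm_nonneg _).trans ?_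
        rw [(hs i).tsum_eq_zero_add, h0, norm_one, add_comm]
        exact Real.add_one_le_exp _
    _ = Real.exp (∑ i ∈ T, ∑' k, ‖g i (k + 1)‖) := (Real.exp_sum _ _).symm
    _ ≤ _ := Real.exp_le_exp.mpr (hsum.sum_le_tsum _ fun i _ => hnn i)

/-- The Euler product of a multiplicative function on effective divisors. -/
theorem hasProd_tsum_finsupp_prod (h0 : ∀ i, g i 0 = 1) (hs : ∀ i, Summable fun k => ‖g i k‖)
    (hsum : Summable fun i => ∑' k, ‖g i (k + 1)‖) :
    HasProd (fun i => ∑' k, g i k) (∑' D : ι →₀ ℕ, D.prod g) := by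
  classical
  have hS := (summable_norm_finsupp_prod h0 hs hsum).of_norm.hasSum
  rw [HasSum, SummationFilter.unconditional_filter, Metric.tendsto_atTop] at hS
  rw [HasProd, SummationFilter.unconditional_filter, Metric.tendsto_atTop]
  intro ε hε
  obtain ⟨S, hS⟩ := hS (ε / 2) (half_pos hε)
  obtain ⟨T, N, hTN⟩ := exists_subset_finsupp S
  -- With `T'` fixed, let `N → ∞`. The limit preserves only `≤`, hence the margin `ε / 2`.
  refine ⟨T, fun T' hT' => lt_of_le_of_lt ?_ (half_lt_self hε)⟩
  have hlim : Filter.Tendsto (fun N => ∏ i ∈ T', ∑ k ∈ Finset.range N, g i k) Filter.atTop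
      (𝓝 (∏ i ∈ T', ∑' k, g i k)) :=
    tendsto_finsetProd _ fun i _ => (hs i).of_norm.hasSum.tendsto_sum_nat
  refine le_of_tendsto (hlim.dist tendsto_const_nhds) ?_
  filter_upwards [Filter.eventually_ge_atTop N] with N' hN'
  rw [← sum_finsupp_prod h0]
  exact (hS _ (hTN T' N' hT' hN')).le

theorem tsum_finsupp_prod_ne_zero (h0 : ∀ i, g i 0 = 1) (hs : ∀ i, Summable fun k => ‖g i k‖)
    (hsum : Summable fun i => ∑' k, ‖g i (k + 1)‖) (hne : ∀ i, ∑' k, g i k ≠ 0) :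
    ∑' D : ι →₀ ℕ, D.prod g ≠ 0 := by
  rw [← (hasProd_tsum_finsupp_prod h0 hs hsum).tprod_eq]
  have h1 : ∀ i, ∑' k, g i k = 1 + ∑' k, g i (k + 1) := fun i => by
    rw [(hs i).of_norm.tsum_eq_zero_add, h0]
  simp_rw [h1] at hne ⊢
  refine tprod_one_add_ne_zero_of_summable hne
    (hsum.of_nonneg_of_le (fun _ => norm_nonneg _) fun i => ?_)
  exact norm_tsum_le_tsum_norm ((summable_nat_add_iff 1).mpr (hs i))

end EulerProduct

/-! ### Convergence and holomorphy of the product `f_K` -/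

/-- Mean value inequality on `[a, a + 1]`: the derivative `-s x^{-s-1}` is largest in norm at `x =
a`. -/
theorem norm_cpow_sub_cpow_add_one_le {a : ℝ} (ha : 0 < a) {s : ℂ} (hs : 0 < s.re) :
    ‖(a : ℂ) ^ (-s) - ((a + 1 : ℝ) : ℂ) ^ (-s)‖ ≤ ‖s‖ * a ^ (-(s.re + 1)) := by
  have hd : ∀ x ∈ Set.Icc a (a + 1), HasDerivWithinAt (fun x : ℝ => (x : ℂ) ^ (-s))
      (-s * (x : ℂ) ^ (-s - 1)) (Set.Icc a (a + 1)) x := by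
    intro x hx
    have hx0 : 0 < x := ha.trans_le hx.1
    have h1 := ((hasDerivAt_id (x : ℂ)).cpow_const (c := -s)
      (Complex.ofReal_mem_slitPlane.mpr hx0)).comp_ofReal
    simpa using h1.hasDerivWithinAt
  have hb : ∀ x ∈ Set.Icc a (a + 1), ‖-s * (x : ℂ) ^ (-s - 1)‖ ≤ ‖s‖ * a ^ (-(s.re + 1)) := by
    intro x hx
    have hx0 : 0 < x := ha.trans_le hx.1
    rw [norm_mul, norm_neg, Complex.norm_cpow_eq_rpow_re_of_pos hx0]
    refine mul_le_mul_of_nonneg_left ?_ (norm_nonneg _)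
    have : (-s - 1).re = -(s.re + 1) := by simp; ring
    rw [this]
    exact Real.rpow_le_rpow_of_nonpos ha hx.1 (by linarith)
  have h := (convex_Icc a (a + 1)).norm_image_sub_le_of_norm_hasDerivWithin_le hd hb
    (Set.right_mem_Icc.mpr (by linarith)) (Set.left_mem_Icc.mpr (by linarith))
  simpa using h

theorem cast_pointNorm_sub_one (hK : IsGlobalField K) (P : ClosedPoint K) :
    ((pointNorm P : ℂ) - 1) = ((pointNorm P - 1 : ℕ) : ℂ) := by
  have := two_le_pointNorm hK P
  push_cast [show 1 ≤ pointNorm P by omega]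
  ring

/-- As `q ≥ 2`, `q - 1 ≥ q / 2`, which costs only a factor `2 ^ σ`. -/
theorem summable_pointNorm_sub_one (hK : IsGlobalField K) {σ : ℝ} (hσ : 1 < σ) :
    Summable fun P : ClosedPoint K => ((pointNorm P - 1 : ℕ) : ℝ) ^ (-σ) := by
  refine ((summable_pointNorm hK hσ).mul_left ((2 : ℝ) ^ σ)).of_nonneg_of_le
    (fun _ => by positivity) fun P => ?_
  have h2 := two_le_pointNorm hK P
  have hle : (pointNorm P : ℝ) / 2 ≤ ((pointNorm P - 1 : ℕ) : ℝ) := by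
    rw [div_le_iff₀ two_pos]
    exact_mod_cast (by omega : pointNorm P ≤ (pointNorm P - 1) * 2)
  have hpos : (0 : ℝ) < pointNorm P := by exact_mod_cast (by omega : 0 < pointNorm P)
  refine (Real.rpow_le_rpow_of_nonpos (by positivity) hle (by linarith)).trans_eq ?_
  rw [Real.div_rpow hpos.le two_pos.le, Real.rpow_neg two_pos.le, div_inv_eq_mul, mul_comm]

theorem norm_eulerFactor_sub_one_le (hK : IsGlobalField K) (P : ClosedPoint K) {s : ℂ}
    (hs : 0 < s.re) :
    ‖((pointNorm P : ℂ) - 1) ^ (-s) - (pointNorm P : ℂ) ^ (-s)‖ ≤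
      ‖s‖ * ((pointNorm P - 1 : ℕ) : ℝ) ^ (-(s.re + 1)) := by
  have h2 := two_le_pointNorm hK P
  have hpos : (0 : ℝ) < (pointNorm P - 1 : ℕ) := by
    exact_mod_cast (by omega : 0 < pointNorm P - 1)
  have h := norm_cpow_sub_cpow_add_one_le hpos hs
  have h3 : (((pointNorm P - 1 : ℕ) : ℝ) + 1) = (pointNorm P : ℝ) := by
    exact_mod_cast (by omega : pointNorm P - 1 + 1 = pointNorm P)
  rw [h3] at h
  rw [cast_pointNorm_sub_one hK]
  exact_mod_cast h

theorem eulerFactor_eq (P : ClosedPoint K) (s : ℂ) :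
    eulerFactor P s = 1 + (((pointNorm P : ℂ) - 1) ^ (-s) - (pointNorm P : ℂ) ^ (-s)) :=
  add_sub_assoc _ _ _

theorem summable_norm_eulerFactor_sub_one (hK : IsGlobalField K) {s : ℂ} (hs : 0 < s.re) :
    Summable fun P : ClosedPoint K => ‖eulerFactor P s - 1‖ := by
  refine ((summable_pointNorm_sub_one hK (σ := s.re + 1) (by linarith)).mul_left
    ‖s‖).of_nonneg_of_le (fun _ => norm_nonneg _) fun P => ?_
  rw [eulerFactor_eq, add_sub_cancel_left]
  exact norm_eulerFactor_sub_one_le hK P hs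

theorem differentiable_eulerFactor (hK : IsGlobalField K) (P : ClosedPoint K) :
    Differentiable ℂ (eulerFactor P) := by
  have h2 := two_le_pointNorm hK P
  have h1 : ((pointNorm P : ℂ) - 1) ≠ 0 := by
    rw [cast_pointNorm_sub_one hK]
    exact_mod_cast (by omega : pointNorm P - 1 ≠ 0)
  have h0 : (pointNorm P : ℂ) ≠ 0 := by exact_mod_cast (by omega : pointNorm P ≠ 0)
  intro s
  exact ((differentiableAt_id.neg.const_cpow (Or.inl h1)).const_add 1).sub
    (differentiableAt_id.neg.const_cpow (Or.inl h0))

theorem hasProdLocallyUniformlyOn_eulerFactor (hK : IsGlobalField K) :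
    HasProdLocallyUniformlyOn (fun (P : ClosedPoint K) (s : ℂ) => eulerFactor P s) (eulerProd K)
      {s : ℂ | 0 < s.re} := by
  refine hasProdLocallyUniformlyOn_of_forall_compact
    (isOpen_lt continuous_const Complex.continuous_re) fun C hC hCc => ?_
  obtain ⟨B, hB⟩ := hCc.isBounded.exists_norm_le
  obtain ⟨δ, hδ, hδC⟩ : ∃ δ : ℝ, 0 < δ ∧ ∀ s ∈ C, δ ≤ s.re := by
    rcases C.eq_empty_or_nonempty with rfl | hne
    · exact ⟨1, one_pos, by simp⟩
    · obtain ⟨x, hx, hmin⟩ := hCc.exists_isMinOn hne Complex.continuous_re.continuousOn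
      exact ⟨x.re, hC hx, fun s hs => hmin hs⟩
  -- On the compact set `|s| ≤ B` and `Re s ≥ δ`, so `B (q-1)^{-(δ+1)}` is a uniform majorant.
  have hsum := (summable_pointNorm_sub_one hK (σ := δ + 1) (by linarith)).mul_left B
  have h := hsum.hasProdUniformlyOn_one_add hCc
    (f := fun (P : ClosedPoint K) (s : ℂ) =>
      ((pointNorm P : ℂ) - 1) ^ (-s) - (pointNorm P : ℂ) ^ (-s))
    (Filter.Eventually.of_forall fun P s hs => ?_) fun P => ?_
  · simp_rw [← eulerFactor_eq] at h
    exact h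
  · have h2 := two_le_pointNorm hK P
    have h1 : (1 : ℝ) ≤ (pointNorm P - 1 : ℕ) := by
      exact_mod_cast (by omega : 1 ≤ pointNorm P - 1)
    refine (norm_eulerFactor_sub_one_le hK P (hC hs)).trans ?_
    refine mul_le_mul (hB s hs) ?_ (by positivity) ((norm_nonneg s).trans (hB s hs))
    exact Real.rpow_le_rpow_of_exponent_le h1 (by linarith [hδC s hs])
  · have h1 := ((differentiable_eulerFactor hK P).continuous.sub continuous_const).continuousOn
      (s := C) (f := fun s => eulerFactor P s - 1)
    simp_rw [eulerFactor_eq, add_sub_cancel_left] at h1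
    exact h1

theorem differentiableOn_eulerProd (hK : IsGlobalField K) :
    DifferentiableOn ℂ (eulerProd K) {s : ℂ | 0 < s.re} := by
  refine (hasProdLocallyUniformlyOn_iff_tendstoLocallyUniformlyOn.mp
    (hasProdLocallyUniformlyOn_eulerFactor hK)).differentiableOn
    (Filter.Eventually.of_forall fun S => ?_) (isOpen_lt continuous_const Complex.continuous_re)
  exact DifferentiableOn.fun_finsetProd fun P _ => (differentiable_eulerFactor hK P).differentiableOn

/-! ### Local coefficients of the two series -/

/-- The local coefficients of `ζ_K` at `s`. -/
def zetaCoeff (s : ℂ) (P : ClosedPoint K) (k : ℕ) : ℂ := ((pointNorm P : ℂ) ^ (-s)) ^ k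

/-- The local coefficients of `T_K` at `s`. -/
def totientCoeff (s : ℂ) (P : ClosedPoint K) : ℕ → ℂ
  | 0 => 1
  | k + 1 => ((pointNorm P : ℂ) - 1) ^ (-s) * ((pointNorm P : ℂ) ^ (-s)) ^ k

theorem natCast_pow_cpow (n k : ℕ) (s : ℂ) : ((n ^ k : ℕ) : ℂ) ^ s = ((n : ℂ) ^ s) ^ k := by
  induction k with
  | zero => simp
  | succ k ih => rw [pow_succ, Nat.cast_mul, Complex.natCast_mul_natCast_cpow, ih, pow_succ]

theorem natCast_finsetProd_cpow {ι : Type*} (S : Finset ι) (f : ι → ℕ) (s : ℂ) :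
    ((∏ i ∈ S, f i : ℕ) : ℂ) ^ s = ∏ i ∈ S, (f i : ℂ) ^ s := by
  classical
  induction S using Finset.induction_on with
  | empty => simp
  | insert a S ha ih =>
    rw [Finset.prod_insert ha, Finset.prod_insert ha, Nat.cast_mul,
      Complex.natCast_mul_natCast_cpow, ih]

theorem norm_cpow_eq_prod (D : EffDivisor K) (s : ℂ) :
    (norm D : ℂ) ^ (-s) = D.prod (zetaCoeff s) := by
  rw [norm_eq_prod_pointNorm, Finsupp.prod, natCast_finsetProd_cpow, Finsupp.prod]
  exact Finset.prod_congr rfl fun P _ => natCast_pow_cpow _ _ _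

theorem euler_cpow_eq_prod (hK : IsGlobalField K) (D : EffDivisor K) (s : ℂ) :
    (euler D : ℂ) ^ (-s) = D.prod (totientCoeff s) := by
  rw [euler_eq_prod (fun P => by have := two_le_pointNorm hK P; omega), Finsupp.prod,
    natCast_finsetProd_cpow, Finsupp.prod]
  refine Finset.prod_congr rfl fun P hP => ?_
  obtain ⟨k, hk⟩ := Nat.exists_eq_succ_of_ne_zero (Finsupp.mem_support_iff.mp hP)
  rw [hk, Nat.succ_eq_add_one, Nat.add_sub_cancel, Nat.cast_mul, Complex.natCast_mul_natCast_cpow,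
    natCast_pow_cpow, totientCoeff, cast_pointNorm_sub_one hK, mul_comm]

theorem euler_pos (hK : IsGlobalField K) (D : EffDivisor K) : 0 < euler D := by
  rw [euler_eq_prod (fun P => by have := two_le_pointNorm hK P; omega)]
  refine Finset.prod_pos fun P _ => ?_
  have := two_le_pointNorm hK P
  exact Nat.mul_pos (Nat.pow_pos (by omega)) (by omega)

/-! ### Euler products and the identity for `Re s > 1` -/

section HalfPlane

variable {s : ℂ}

theorem norm_pointNorm_cpow (hK : IsGlobalField K) (P : ClosedPoint K) (s : ℂ) :
    ‖(pointNorm P : ℂ) ^ (-s)‖ = (pointNorm P : ℝ) ^ (-s.re) := by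
  have := two_le_pointNorm hK P
  rw [Complex.norm_natCast_cpow_of_pos (by omega), Complex.neg_re]

/-- A bound uniform in `P`: every local geometric series has norm sum at most `2`, so each tail is
at most twice its first term. -/
theorem norm_pointNorm_cpow_le (hK : IsGlobalField K) (hs : 1 < s.re) (P : ClosedPoint K) :
    ‖(pointNorm P : ℂ) ^ (-s)‖ ≤ 1 / 2 := by
  have h2 := two_le_pointNorm hK P
  have h2' : (2 : ℝ) ≤ pointNorm P := by exact_mod_cast h2
  rw [norm_pointNorm_cpow hK]
  calc (pointNorm P : ℝ) ^ (-s.re) ≤ (pointNorm P : ℝ) ^ (-1 : ℝ) :=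
        Real.rpow_le_rpow_of_exponent_le (by linarith) (by linarith)
    _ ≤ 1 / 2 := by
        rw [Real.rpow_neg_one, one_div]
        exact inv_anti₀ two_pos h2'

theorem tsum_norm_pow_le {x : ℂ} (hx : ‖x‖ ≤ 1 / 2) : ∑' k : ℕ, ‖x ^ k‖ ≤ 2 := by
  simp_rw [norm_pow]
  rw [tsum_geometric_of_lt_one (norm_nonneg _) (by linarith), inv_le_comm₀ (by linarith) two_pos]
  linarith

theorem summable_norm_pow {x : ℂ} (hx : ‖x‖ ≤ 1 / 2) : Summable fun k : ℕ => ‖x ^ k‖ := by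
  simp_rw [norm_pow]
  exact summable_geometric_of_lt_one (norm_nonneg _) (by linarith)

theorem summable_norm_zetaCoeff (hK : IsGlobalField K) (hs : 1 < s.re) (P : ClosedPoint K) :
    Summable fun k => ‖zetaCoeff s P k‖ :=
  summable_norm_pow (norm_pointNorm_cpow_le hK hs P)

theorem summable_tsum_norm_zetaCoeff (hK : IsGlobalField K) (hs : 1 < s.re) :
    Summable fun P : ClosedPoint K => ∑' k, ‖zetaCoeff s P (k + 1)‖ := by
  refine ((summable_pointNorm hK hs).mul_right 2).of_nonneg_of_le
    (fun _ => tsum_nonneg fun _ => norm_nonneg _) fun P => ?_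
  simp_rw [zetaCoeff, pow_succ', norm_mul, tsum_mul_left]
  rw [norm_pointNorm_cpow hK]
  exact mul_le_mul_of_nonneg_left (tsum_norm_pow_le (norm_pointNorm_cpow_le hK hs P))
    (by positivity)

theorem summable_norm_totientCoeff (hK : IsGlobalField K) (hs : 1 < s.re) (P : ClosedPoint K) :
    Summable fun k => ‖totientCoeff s P k‖ := by
  rw [← summable_nat_add_iff 1]
  simp_rw [totientCoeff, norm_mul]
  exact (summable_norm_pow (norm_pointNorm_cpow_le hK hs P)).mul_left _

theorem summable_tsum_norm_totientCoeff (hK : IsGlobalField K) (hs : 1 < s.re) :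
    Summable fun P : ClosedPoint K => ∑' k, ‖totientCoeff s P (k + 1)‖ := by
  refine ((summable_pointNorm_sub_one hK hs).mul_right 2).of_nonneg_of_le
    (fun _ => tsum_nonneg fun _ => norm_nonneg _) fun P => ?_
  have h2 := two_le_pointNorm hK P
  simp_rw [totientCoeff, norm_mul, tsum_mul_left]
  rw [cast_pointNorm_sub_one hK, Complex.norm_natCast_cpow_of_pos (by omega), Complex.neg_re]
  exact mul_le_mul_of_nonneg_left (tsum_norm_pow_le (norm_pointNorm_cpow_le hK hs P))
    (by positivity)

theorem tsum_zetaCoeff (hK : IsGlobalField K) (hs : 1 < s.re) (P : ClosedPoint K) :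
    ∑' k, zetaCoeff s P k = (1 - (pointNorm P : ℂ) ^ (-s))⁻¹ :=
  tsum_geometric_of_norm_lt_one ((norm_pointNorm_cpow_le hK hs P).trans_lt (by norm_num))

theorem one_sub_pointNorm_cpow_ne_zero (hK : IsGlobalField K) (hs : 1 < s.re)
    (P : ClosedPoint K) : 1 - (pointNorm P : ℂ) ^ (-s) ≠ 0 := by
  intro h
  have h1 := norm_pointNorm_cpow_le hK hs P
  rw [← sub_eq_zero.mp h, norm_one] at h1
  norm_num at h1

theorem tsum_totientCoeff (hK : IsGlobalField K) (hs : 1 < s.re) (P : ClosedPoint K) :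
    ∑' k, totientCoeff s P k = (∑' k, zetaCoeff s P k) * eulerFactor P s := by
  rw [(summable_norm_totientCoeff hK hs P).of_norm.tsum_eq_zero_add]
  simp_rw [totientCoeff, tsum_mul_left]
  rw [tsum_zetaCoeff hK hs, eulerFactor, tsum_geometric_of_norm_lt_one
    ((norm_pointNorm_cpow_le hK hs P).trans_lt (by norm_num))]
  have := one_sub_pointNorm_cpow_ne_zero hK hs P
  field_simp
  ring

theorem summable_norm_norm_cpow (hK : IsGlobalField K) (hs : 1 < s.re) :
    Summable fun D : EffDivisor K => ‖(norm D : ℂ) ^ (-s)‖ := by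
  simp_rw [norm_cpow_eq_prod]
  exact summable_norm_finsupp_prod (fun _ => pow_zero _) (summable_norm_zetaCoeff hK hs)
    (summable_tsum_norm_zetaCoeff hK hs)

theorem summable_norm_euler_cpow (hK : IsGlobalField K) (hs : 1 < s.re) :
    Summable fun D : EffDivisor K => ‖(euler D : ℂ) ^ (-s)‖ := by
  simp_rw [euler_cpow_eq_prod hK]
  exact summable_norm_finsupp_prod (fun _ => rfl) (summable_norm_totientCoeff hK hs)
    (summable_tsum_norm_totientCoeff hK hs)

theorem hasProd_weilZeta (hK : IsGlobalField K) (hs : 1 < s.re) :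
    HasProd (fun P : ClosedPoint K => ∑' k, zetaCoeff s P k) (weilZeta K s) := by
  simp_rw [weilZeta, norm_cpow_eq_prod]
  exact hasProd_tsum_finsupp_prod (fun _ => pow_zero _) (summable_norm_zetaCoeff hK hs)
    (summable_tsum_norm_zetaCoeff hK hs)

theorem hasProd_totientZeta (hK : IsGlobalField K) (hs : 1 < s.re) :
    HasProd (fun P : ClosedPoint K => ∑' k, totientCoeff s P k) (totientZeta K s) := by
  simp_rw [totientZeta, euler_cpow_eq_prod hK]
  exact hasProd_tsum_finsupp_prod (fun _ => rfl) (summable_norm_totientCoeff hK hs)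
    (summable_tsum_norm_totientCoeff hK hs)

theorem weilZeta_ne_zero (hK : IsGlobalField K) (hs : 1 < s.re) : weilZeta K s ≠ 0 := by
  simp_rw [weilZeta, norm_cpow_eq_prod]
  refine tsum_finsupp_prod_ne_zero (fun _ => pow_zero _) (summable_norm_zetaCoeff hK hs)
    (summable_tsum_norm_zetaCoeff hK hs) fun P => ?_
  rw [tsum_zetaCoeff hK hs]
  exact inv_ne_zero (one_sub_pointNorm_cpow_ne_zero hK hs P)

/-- The products of `ζ_K` and `f_K` multiply factor by factor to that of `T_K`; limits are unique.
-/
theorem totientZeta_eq_mul (hK : IsGlobalField K) (hs : 1 < s.re) :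
    totientZeta K s = weilZeta K s * eulerProd K s := by
  have h := (hasProd_weilZeta hK hs).mul
    ((hasProdLocallyUniformlyOn_eulerFactor hK).hasProd (x := s) (zero_lt_one.trans hs))
  simp_rw [← tsum_totientCoeff hK hs] at h
  exact (hasProd_totientZeta hK hs).unique h

end HalfPlane

/-- Weierstrass test: as `φ_K(D) ≥ 1`, the terms at `s = 1 + δ` dominate the whole half plane. -/
theorem tendstoUniformlyOn_totientZeta (hK : IsGlobalField K) {δ : ℝ} (hδ : 0 < δ) :
    TendstoUniformlyOn
      (fun (S : Finset (EffDivisor K)) (s : ℂ) => ∑ D ∈ S, (euler D : ℂ) ^ (-s))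
      (totientZeta K) Filter.atTop {s : ℂ | 1 + δ ≤ s.re} := by
  have hsum := summable_norm_euler_cpow hK (s := ((1 + δ : ℝ) : ℂ))
    (by rw [Complex.ofReal_re]; linarith)
  refine tendstoUniformlyOn_tsum hsum fun D s hs => ?_
  have hpos := euler_pos hK D
  rw [Complex.norm_natCast_cpow_of_pos hpos, Complex.norm_natCast_cpow_of_pos hpos,
    Complex.neg_re, Complex.neg_re, Complex.ofReal_re]
  exact Real.rpow_le_rpow_of_exponent_le (by exact_mod_cast hpos) (neg_le_neg hs)

end GlobalTotient

end

theorem theoremC (K : Type*) [Field K] (hK : GlobalTotient.IsGlobalField K) :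
    -- absolute convergence of the series `T_K(s)` for `Re s > 1`
    (∀ s : ℂ, 1 < s.re →
      Summable fun D : GlobalTotient.EffDivisor K => ‖(GlobalTotient.euler D : ℂ) ^ (-s)‖) ∧
    -- uniform convergence on every half plane `Re s ≥ 1 + δ`
    (∀ δ : ℝ, 0 < δ →
      TendstoUniformlyOn
        (fun (S : Finset (GlobalTotient.EffDivisor K)) (s : ℂ) =>
          ∑ D ∈ S, (GlobalTotient.euler D : ℂ) ^ (-s))
        (GlobalTotient.totientZeta K) Filter.atTop {s : ℂ | 1 + δ ≤ s.re}) ∧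
    -- the identity, with a convergent nonvanishing zeta function, for `Re s > 1`
    (∀ s : ℂ, 1 < s.re →
      (Summable fun D : GlobalTotient.EffDivisor K => ‖(GlobalTotient.norm D : ℂ) ^ (-s)‖) ∧
      GlobalTotient.weilZeta K s ≠ 0 ∧
      GlobalTotient.totientZeta K s =
        GlobalTotient.weilZeta K s * GlobalTotient.eulerProd K s ∧
      GlobalTotient.totientZeta K s / GlobalTotient.weilZeta K s =
        GlobalTotient.eulerProd K s) ∧
    -- the product converges absolutely and locally uniformly to a holomorphic function
    -- for `Re s > 0`
    (∀ s : ℂ, 0 < s.re →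
      Summable fun P : GlobalTotient.ClosedPoint K => ‖GlobalTotient.eulerFactor P s - 1‖) ∧
    HasProdLocallyUniformlyOn
      (fun (P : GlobalTotient.ClosedPoint K) (s : ℂ) => GlobalTotient.eulerFactor P s)
      (GlobalTotient.eulerProd K) {s : ℂ | 0 < s.re} ∧
    DifferentiableOn ℂ (GlobalTotient.eulerProd K) {s : ℂ | 0 < s.re} := by
  refine ⟨fun s hs => GlobalTotient.summable_norm_euler_cpow hK hs,
    fun δ hδ => GlobalTotient.tendstoUniformlyOn_totientZeta hK hδ, fun s hs => ?_,
    fun s hs => GlobalTotient.summable_norm_eulerFactor_sub_one hK hs,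
    GlobalTotient.hasProdLocallyUniformlyOn_eulerFactor hK,
    GlobalTotient.differentiableOn_eulerProd hK⟩
  have h0 := GlobalTotient.weilZeta_ne_zero hK hs
  have h1 := GlobalTotient.totientZeta_eq_mul hK hs
  exact ⟨GlobalTotient.summable_norm_norm_cpow hK hs, h0, h1, by rw [h1, mul_div_cancel_left₀ _ h0]⟩
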